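/- **Theorem.** There is a function $f:\mathbb N\to\mathbb N$, $k\mapsto f_k$, with $f_k=O(2^{k/2})$ as $k\to\infty$, such that the following holds for all integers $k,n\ge 0$ and every symmetric matrix $A=(a_{uv})\in\{0,1\}^{n\times n}$ with zero diagonal and $\operatorname{rank}(A)\le k$ (the adjacency matrix of a simple graph on $[n]$). (1) Call $u,v\in[n]$ *twins* if $a_{uv}=0$ and the rows $u$ and $v$ of $A$ coincide (non-adjacent vertices with the same neighbours; each vertex is its own twin). The classes of twins can be labelled by $[f_k]$, i.e. there is a map $\mathcal P:[n]\to[f_k]$ such that $\mathcal P(u)=\mathcal P(v)$ if and only if $u$ and $v$ are twins; in particular there are at most $f_k$ classes. (2) Let $\mathcal P:[n]\to[f_k]$ be any map (for instance the one in (1)) such that vertices with the same value of $\mathcal P$ have identical rows in $A$. For $j\in[f_k]$ put $P_j=\mathcal P^{-1}(j)$ and $n_j=|P_j|$ (possibly $0$), and for $p,q\in[f_k]$ let $\tilde a_{pq}=1$ if $a_{uv}=1$ for all $u\in P_p$, $v\in P_q$, and $\tilde a_{pq}=0$ otherwise. Let $\ell_n\ge 0$ and $i_0\in[n]$. - ${\sf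 BP}(i_0)$ is the $n$-type branching process whose root has type $i_0$ and in which every particle of type $i$ has, independently for $j\in[n]$, $\mathrm{Poi}(\ell_n a_{ij})$ children of type $j$; the mark of a particle is its type. - ${\sf MBP}_{f_k}(i_0)$ is the marked $f_k$-type branching process whose root has mark $i_0$, in which every particle with mark $i$ has, independently for $j\in[f_k]$, $\mathrm{Poi}(n_j\ell_n\tilde a_{\mathcal P(i)j})$ children of type $j$, and in which every child of type $j$ independently receives a mark chosen uniformly from $P_j$. Different particles reproduce independently. Then ${\sf MBP}_{f_k}(i_0)$ and ${\sf BP}(i_0)$, each viewed as the random family tree (with unordered siblings) whose particles carry their marks in $[n]$, have the same distribution. -/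

import Mathlib

open MeasureTheory ProbabilityTheory Asymptotics Filter
open scoped NNReal

noncomputable section

namespace KotlovLovasz

/-! ### Marked family trees -/

/-- Rooted trees of height at most `d` whose particles carry a mark in `Fin n`, where siblings are
not ordered: the mark of the root, together with the multiset of the trees of its children. -/
def MarkedTree (n : ℕ) : ℕ → Type
  | 0 => Fin n
  | d + 1 => Fin n × Multiset (MarkedTree n d)

/-- There are countably many such trees, and every set of them is measurable. -/
instance (n d : ℕ) : MeasurableSpace (MarkedTree n d) := ⊤

/-! ### Marked multi-type branching processes -/

/-- The randomness attached to one individual: `count i j` is the number of its children of type `j`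
in case its own mark is `i`, and `mark j r` is the mark of its `r`-th child of type `j`. -/
abbrev Offspring (n m : ℕ) : Type := (Fin n → Fin m → ℕ) × (Fin m → ℕ → Fin n)

/-- Individuals are labelled by words (Ulam–Harris): the word `[(j₁, r₁), …, (j_g, r_g)]` is the
`r_g`-th child of type `j_g` of … of the `r₁`-th child of type `j₁` of the root `[]`. -/
abbrev Sample (n m : ℕ) : Type := List (Fin m × ℕ) → Offspring n m

/-- Law of the randomness of one individual: all the coordinates are independent, `count i j` is
Poisson with parameter `rate i j`, and `mark j r` has law `markLaw j`. -/
def offspringLaw {n m : ℕ} (rate : Fin n → Fin m → ℝ≥0) (markLaw : Fin m → PMF (Fin n)) :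
    Measure (Offspring n m) :=
  (Measure.pi fun i => Measure.pi fun j => poissonMeasure (rate i j)).prod
    (Measure.pi fun j => Measure.infinitePi fun _ : ℕ => (markLaw j).toMeasure)

instance {n m : ℕ} (rate : Fin n → Fin m → ℝ≥0) (markLaw : Fin m → PMF (Fin n)) :
    IsProbabilityMeasure (offspringLaw rate markLaw) := by
  unfold offspringLaw; infer_instance

/-- The probability measure governing the branching process: distinct individuals are
independent. -/
def sampleLaw {n m : ℕ} (rate : Fin n → Fin m → ℝ≥0) (markLaw : Fin m → PMF (Fin n)) :
    Measure (Sample n m) :=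
  Measure.infinitePi fun _ => offspringLaw rate markLaw

/-- The family tree up to generation `d`, with its marks, of a root with mark `i`. The descendants
of the `r`-th child of type `j` of the root use the part of the sample below the label `(j, r)`. -/
def familyTree {n m : ℕ} : (d : ℕ) → Sample n m → Fin n → MarkedTree n d
  | 0, _, i => i
  | d + 1, ω, i =>
      (i, ∑ j : Fin m, (Multiset.range ((ω []).1 i j)).map fun r =>
        familyTree d (fun v => ω ((j, r) :: v)) ((ω []).2 j r))

/-- The whole branching process started from a root with mark `i₀`: the sequence over `d` of its
marked family trees up to generation `d`. -/
def process {n m : ℕ} (i₀ : Fin n) (ω : Sample n m) : (d : ℕ) → MarkedTree n d :=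
  fun d => familyTree d ω i₀

/-! ### The `n`-type branching process of a matrix -/

/-- A particle of type `i` has `Poi (ℓ a_ij)` children of type `j`. -/
def bpRate {n : ℕ} (A : Matrix (Fin n) (Fin n) ℝ) (ℓ : ℝ≥0) (i j : Fin n) : ℝ≥0 :=
  ℓ * (A i j).toNNReal

/-- Law of the sample of the `n`-type process: marks and types are the same. -/
def bpLaw {n : ℕ} (A : Matrix (Fin n) (Fin n) ℝ) (ℓ : ℝ≥0) : Measure (Sample n n) :=
  sampleLaw (bpRate A ℓ) PMF.pure

/-! ### Partitions into classes of twins and the marked process with one type per class -/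

/-- Twins: non-adjacent vertices with the same neighbours (a vertex counts as its own twin). -/
def Twins {n : ℕ} (A : Matrix (Fin n) (Fin n) ℝ) (u v : Fin n) : Prop :=
  A u v = 0 ∧ ∀ w, A u w = A v w

/-- All the vertices in a class of the partition (given by its class map `P`) have identical
neighbours. -/
def IsCanonical {n m : ℕ} (A : Matrix (Fin n) (Fin n) ℝ) (P : Fin n → Fin m) : Prop :=
  ∀ u v, P u = P v → ∀ w, A u w = A v w

/-- The class with label `j`; it may be empty. -/
def cls {n m : ℕ} (P : Fin n → Fin m) (j : Fin m) : Finset (Fin n) :=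
  Finset.univ.filter fun v => P v = j

open Classical in
/-- The proxy adjacency matrix: `1` if all edges between the two classes are present, else `0`. -/
def proxy {n m : ℕ} (A : Matrix (Fin n) (Fin n) ℝ) (P : Fin n → Fin m) :
    Matrix (Fin m) (Fin m) ℝ≥0 :=
  fun p q => if ∀ u ∈ cls P p, ∀ v ∈ cls P q, A u v = 1 then 1 else 0

/-- A particle with mark `i` has `Poi (n_j ℓ ã_{P(i) j})` children of type `j`, where `n_j` is the
size of the class `j`. -/
def mbpRate {n m : ℕ} (A : Matrix (Fin n) (Fin n) ℝ) (ℓ : ℝ≥0) (P : Fin n → Fin m)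
    (i : Fin n) (j : Fin m) : ℝ≥0 :=
  ((cls P j).card : ℝ≥0) * ℓ * proxy A P (P i) j

open Classical in
/-- The mark of a particle of type `j` is uniform on the class `j`. A type with an empty class has
no particles (its Poisson parameter is `0`), and an arbitrary value `i₀` is used for it. -/
def mbpMark {n m : ℕ} (P : Fin n → Fin m) (i₀ : Fin n) (j : Fin m) : PMF (Fin n) :=
  if h : (cls P j).Nonempty then PMF.uniformOfFinset (cls P j) h else PMF.pure i₀

/-- Law of the sample of the marked process with one type per class. -/
def mbpLaw {n m : ℕ} (A : Matrix (Fin n) (Fin n) ℝ) (ℓ : ℝ≥0) (P : Fin n → Fin m)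
    (i₀ : Fin n) : Measure (Sample n m) :=
  sampleLaw (mbpRate A ℓ P) (mbpMark P i₀)

end KotlovLovasz

end

/-! Equality of the processes is Poisson thinning. Given the root's children, their subtrees are
independent, so the Poisson generating function gives `E ∏ z(subtree) = exp (∑ a, λ i a * (G a -
1))`, where `λ i a = ∑ j, rate i j * markLaw j a` and `G a` is the mean of `z` over the tree of a
root with mark `a` (`lintegral_prod_map_children_eq_exp`). Such functionals determine the law of a
random multiset, so by induction on the height the law of the tree depends only on `λ`. Both
processes have `λ i a = ℓ * A i a`: in the marked one, `n_j` in the rate cancels `1 / n_j` in the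
uniform mark.

The bound on the number of twin classes counts distinct rows of a symmetric 0/1 matrix, by strong
induction on the rank `r` (`card_le_of_rank_le`). Repeated rows may be deleted. Let `x` be a nonzero
vector of minimal weight in the row space. (a) If the weight is at least `0.28 |V|`, the rows form a
code of large distance; as sign vectors they give a spherical code in dimension at most `r + 1`, and
a volume argument bounds its size by a multiple of `√2 ^ r`. (b) Otherwise, restrict to the zero set
of `x`. This lowers the rank and keeps more than `0.72 |V|` vertices; if the rows stay distinct, `1
/ 0.72 < √2` suffices. (c) If two rows become equal, their difference `y` also has minimal weight.
Restricting to the zero set of `y` lowers the rank by two, and by minimality rows coincide at most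
in pairs, so the size is at most twice the number of distinct rows, plus 4
(`card_le_of_minimal_difference`, through the Plotkin bound). -/

namespace KotlovLovasz

open scoped ENNReal

universe u

/-! ### Generating functionals of random multisets -/

/-- The law of a random multiset is determined by its generating functional. -/
theorem measure_multiset_ext_of_lintegral_prod {X : Type*} [Countable X]
    [MeasurableSpace (Multiset X)] [DiscreteMeasurableSpace (Multiset X)]
    {μ ν : Measure (Multiset X)} [IsProbabilityMeasure μ] [IsProbabilityMeasure ν]
    (h : ∀ z : X → ℝ≥0, (∀ x, z x ≤ 1) →
      ∫⁻ M, ((M.map z).prod : ℝ≥0) ∂μ = ∫⁻ M, ((M.map z).prod : ℝ≥0) ∂ν) : μ = ν := by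
  classical
  let _ : TopologicalSpace (Multiset X) := ⊥
  have : DiscreteTopology (Multiset X) := ⟨rfl⟩
  have hle : ∀ z : X → ℝ≥0, (∀ x, z x ≤ 1) → ∀ M : Multiset X, (M.map z).prod ≤ 1 := by
    intro z hz M
    induction M using Multiset.induction_on with
    | empty => simp
    | cons a M ih => simpa using mul_le_one' (hz a) ih
  -- Products of these functions are again of this form, so their span is an algebra; a
  -- point-separating algebra of bounded continuous functions on a Polish space (here countable and
  -- discrete) determines a probability measure.
  let S : Set (BoundedContinuousFunction (Multiset X) ℝ) :=
    {g | ∃ z : X → ℝ≥0, (∀ x, z x ≤ 1) ∧ ∀ M, g M = ((M.map z).prod : ℝ≥0)}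
  have hmem : ∀ z : X → ℝ≥0, (∀ x, z x ≤ 1) → ∃ g ∈ S, ∀ M, g M = ((M.map z).prod : ℝ≥0) := by
    intro z hz
    refine ⟨BoundedContinuousFunction.ofNormedAddCommGroupDiscrete
      (fun M => ((M.map z).prod : ℝ≥0)) 1 fun M => ?_, ⟨z, hz, fun M => rfl⟩, fun M => rfl⟩
    simpa using hle z hz M
  have hone : (1 : BoundedContinuousFunction (Multiset X) ℝ) ∈ Submodule.span ℝ S :=
    Submodule.subset_span ⟨fun _ => 1, fun _ => le_rfl, fun M => by simp⟩
  have hmul : ∀ f g, f ∈ Submodule.span ℝ S → g ∈ Submodule.span ℝ S →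
      f * g ∈ Submodule.span ℝ S := by
    intro f g hf hg
    have : f * g ∈ Submodule.span ℝ S * Submodule.span ℝ S := Submodule.mul_mem_mul hf hg
    rw [Submodule.span_mul_span] at this
    refine Submodule.span_mono ?_ this
    rintro _ ⟨f, ⟨z, hz, hf⟩, g, ⟨y, hy, hg⟩, rfl⟩
    refine ⟨fun x => z x * y x, fun x => mul_le_one' (hz x) (hy x), fun M => ?_⟩
    simp [hf, hg, Multiset.prod_map_mul]
  let A : StarSubalgebra ℝ (BoundedContinuousFunction (Multiset X) ℝ) :=
    { (Submodule.span ℝ S).toSubalgebra hone hmul with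
      star_mem' := fun {a} ha => by
        rwa [show star a = a from BoundedContinuousFunction.ext fun _ => star_trivial _] }
  have hA : ∀ g, g ∈ A ↔ g ∈ Submodule.span ℝ S := fun g => Iff.rfl
  refine ext_of_forall_mem_subalgebra_integral_eq_of_polish (A := A) ?_ ?_
  · intro M N hMN
    obtain ⟨x, hx⟩ : ∃ x, M.count x ≠ N.count x := by
      by_contra! hcon
      exact hMN (Multiset.ext.2 hcon)
    -- With weight 1/2 at `x` and 1 elsewhere, the product is `2⁻¹ ^ count x`, which separates `M`
    -- from `N`.
    obtain ⟨g, hgS, hg⟩ := hmem (fun y => if y = x then 2⁻¹ else 1) fun y => by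
      split_ifs
      · exact inv_le_one_of_one_le₀ one_le_two
      · exact le_rfl
    have hprod : ∀ K : Multiset X,
        (K.map fun y => if y = x then (2⁻¹ : ℝ≥0) else 1).prod = 2⁻¹ ^ K.count x := by
      intro K
      induction K using Multiset.induction_on with
      | empty => simp
      | cons a K ih =>
        by_cases hax : a = x
        · simp [hax, ih, pow_succ']
        · simp [hax, ih, Multiset.count_cons_of_ne (Ne.symm hax)]
    refine ⟨g, ⟨g.toContinuousMap, ⟨g, (hA g).2 (Submodule.subset_span hgS), rfl⟩, rfl⟩, ?_⟩
    intro hEq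
    change g M = g N at hEq
    rw [hg, hg, hprod, hprod] at hEq
    exact hx (pow_right_injective₀ (by positivity) (by norm_num) (NNReal.coe_injective hEq))
  · intro g hg
    rw [hA] at hg
    induction hg using Submodule.span_induction with
    | mem g hg =>
      obtain ⟨z, hz, hg⟩ := hg
      have key : ∀ ρ : Measure (Multiset X),
          ∫ M, g M ∂ρ = (∫⁻ M, ((M.map z).prod : ℝ≥0) ∂ρ).toReal := by
        intro ρ
        simp_rw [hg]
        rw [integral_eq_lintegral_of_nonneg_ae (ae_of_all _ fun M => NNReal.coe_nonneg _)
          (Measurable.of_discrete.aestronglyMeasurable)]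
        simp
      rw [key, key, h z hz]
    | zero => simp
    | add f g _ _ hf hg =>
      simp only [BoundedContinuousFunction.coe_add, Pi.add_apply]
      rw [integral_add (f.integrable _) (g.integrable _),
        integral_add (f.integrable _) (g.integrable _), hf, hg]
    | smul c f _ hf =>
      simp only [BoundedContinuousFunction.coe_smul, smul_eq_mul]
      rw [integral_const_mul, integral_const_mul, hf]

/-- The generating function of the Poisson distribution. -/
theorem lintegral_pow_poissonMeasure (r : ℝ≥0) {g : ℝ} (hg : 0 ≤ g) :
    ∫⁻ k, ENNReal.ofReal g ^ k ∂poissonMeasure r =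
      ENNReal.ofReal (Real.exp (r * (g - 1))) := by
  have hsum : HasSum (fun k : ℕ => Real.exp (-r) * r ^ k / k.factorial * g ^ k)
      (Real.exp (r * (g - 1))) := by
    have h := (NormedSpace.expSeries_div_hasSum_exp (𝔸 := ℝ) (r * g)).mul_left (Real.exp (-r))
    rw [← Real.exp_eq_exp_ℝ, ← Real.exp_add] at h
    have e : (fun k : ℕ => Real.exp (-r) * r ^ k / k.factorial * g ^ k) =
        fun k : ℕ => Real.exp (-r) * ((r * g) ^ k / k.factorial) := by
      ext k; rw [mul_pow]; ring
    rwa [e, show (r : ℝ) * (g - 1) = -r + r * g by ring]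
  rw [lintegral_countable', ← hsum.tsum_eq, ENNReal.ofReal_tsum_of_nonneg
    (fun k => by positivity) hsum.summable]
  congr 1 with k
  rw [poissonMeasure_singleton, ENNReal.ofReal_mul (by positivity), mul_comm,
    ENNReal.ofReal_pow hg]

section Laws

/-! ### Measurability of the family tree -/

instance (n d : ℕ) : DiscreteMeasurableSpace (MarkedTree n d) := ⟨fun _ => trivial⟩

instance countable_markedTree (n : ℕ) : ∀ d, Countable (MarkedTree n d)
  | 0 => inferInstanceAs (Countable (Fin n))
  | d + 1 =>
    have := countable_markedTree n d
    inferInstanceAs (Countable (Fin n × Multiset (MarkedTree n d)))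

/-- Every set of multisets of trees is measurable. -/
instance (n d : ℕ) : MeasurableSpace (Multiset (MarkedTree n d)) := ⊤

instance (n d : ℕ) : DiscreteMeasurableSpace (Multiset (MarkedTree n d)) := ⟨fun _ => trivial⟩

variable {n m : ℕ}

/-- The tree with the given mark of the root and the given multiset of trees of its children. -/
def MarkedTree.node {d : ℕ} (i : Fin n) (M : Multiset (MarkedTree n d)) : MarkedTree n (d + 1) :=
  (i, M)

/-- The multiset of the trees of the children of the root. -/
def children (d : ℕ) (ω : Sample n m) (i : Fin n) : Multiset (MarkedTree n d) :=
  ∑ j : Fin m, (Multiset.range ((ω []).1 i j)).map fun r =>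
    familyTree d (fun v => ω ((j, r) :: v)) ((ω []).2 j r)

theorem measurable_finset_sum_multiset {Ω ι : Type*} [MeasurableSpace Ω] {d : ℕ} (s : Finset ι)
    {f : ι → Ω → Multiset (MarkedTree n d)} (hf : ∀ i, Measurable (f i)) :
    Measurable fun ω => ∑ i ∈ s, f i ω := by
  classical
  induction s using Finset.induction_on with
  | empty => simp
  | insert a s ha ih =>
    simp only [Finset.sum_insert ha]
    exact (Measurable.of_discrete (f := fun p : Multiset (MarkedTree n d) ×
      Multiset (MarkedTree n d) => p.1 + p.2)).comp ((hf a).prodMk ih)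

theorem measurable_children {d : ℕ}
    (h : ∀ i, Measurable fun ω : Sample n m => familyTree d ω i) (i : Fin n) :
    Measurable fun ω : Sample n m => children d ω i := by
  have hsub : ∀ p : Fin m × ℕ, Measurable fun ω : Sample n m =>
      familyTree d (fun v => ω (p :: v)) ((ω []).2 p.1 p.2) := by
    intro p
    have h1 : Measurable fun q : Fin n × Sample n m => familyTree d q.2 q.1 :=
      measurable_from_prod_countable_right h
    exact h1.comp (f := fun ω : Sample n m => ((ω []).2 p.1 p.2, fun v => ω (p :: v)))
      (by fun_prop)
  -- The numbers of children range over a countable set, so they can be frozen and the sums become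
  -- sums over fixed index sets.
  have h2 : Measurable fun q : (Fin m → ℕ) × Sample n m =>
      ∑ j : Fin m, (Multiset.range (q.1 j)).map fun r =>
        familyTree d (fun v => q.2 ((j, r) :: v)) ((q.2 []).2 j r) := by
    refine measurable_from_prod_countable_right fun c => ?_
    refine measurable_finset_sum_multiset _ fun j => ?_
    have : ∀ ω : Sample n m, ((Multiset.range (c j)).map fun r =>
        familyTree d (fun v => ω ((j, r) :: v)) ((ω []).2 j r)) =
        ∑ r ∈ Finset.range (c j),
          {familyTree d (fun v => ω ((j, r) :: v)) ((ω []).2 j r)} := by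
      intro ω
      simp only [Finset.sum, Finset.range_val]
      rw [← Multiset.sum_map_singleton (Multiset.map _ _), Multiset.map_map]
      rfl
    simp_rw [this]
    exact measurable_finset_sum_multiset _ fun r =>
      (Measurable.of_discrete (f := fun t : MarkedTree n d =>
        ({t} : Multiset (MarkedTree n d)))).comp (hsub (j, r))
  exact h2.comp (f := fun ω : Sample n m => ((ω []).1 i, ω)) (by fun_prop)

theorem measurable_familyTree (d : ℕ) (i : Fin n) :
    Measurable fun ω : Sample n m => familyTree d ω i := by
  induction d generalizing i with
  | zero => exact measurable_const
  | succ d ih =>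
    exact (Measurable.of_discrete (f := MarkedTree.node i)).comp (measurable_children ih i)

/-! ### Independence of the root and the subtrees -/

/-- The sample assembled from the randomness of the root and the samples of the subtrees. -/
def graft (q : Offspring n m × (Fin m × ℕ → Sample n m)) : Sample n m
  | [] => q.1
  | p :: v => q.2 p v

theorem measurable_graft : Measurable (graft : _ → Sample n m) := by
  refine measurable_pi_iff.2 fun l => ?_
  cases l with
  | nil => exact measurable_fst
  | cons p v => exact (measurable_pi_apply v).comp ((measurable_pi_apply p).comp measurable_snd)

variable (rate : Fin n → Fin m → ℝ≥0) (markLaw : Fin m → PMF (Fin n))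

instance : IsProbabilityMeasure (sampleLaw rate markLaw) := by
  unfold sampleLaw; infer_instance

/-- The branching property: the words below distinct first letters form disjoint blocks of
independent coordinates, each a copy of the full index set. It suffices to compare finite boxes. -/
theorem map_graft :
    ((offspringLaw rate markLaw).prod
      (Measure.infinitePi fun _ : Fin m × ℕ => sampleLaw rate markLaw)).map graft =
      sampleLaw rate markLaw := by
  classical
  refine Measure.eq_infinitePi _ fun s t ht => ?_
  rw [Measure.map_apply measurable_graft
    (MeasurableSet.pi s.countable_toSet fun _ _ => ht _)]
  let s' : Finset ((Fin m × ℕ) × List (Fin m × ℕ)) :=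
    s.preimage (fun p => p.1 :: p.2) (by
      rintro ⟨a, b⟩ _ ⟨c, d⟩ _ h
      simpa using h)
  have hs' : ∀ p, p ∈ s' ↔ p.1 :: p.2 ∈ s := fun p => Finset.mem_preimage
  let t₀ : Set (Offspring n m) := if [] ∈ s then t [] else Set.univ
  have hpre : graft ⁻¹' ((s : Set (List (Fin m × ℕ))).pi t) =
      t₀ ×ˢ ((MeasurableEquiv.curry _ _ _).symm ⁻¹'
        ((s' : Set ((Fin m × ℕ) × List (Fin m × ℕ))).pi fun p => t (p.1 :: p.2))) := by
    ext ⟨o, η⟩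
    simp only [Set.mem_preimage, Set.mem_pi, Finset.mem_coe, Set.mem_prod, t₀, hs']
    constructor
    · intro h
      refine ⟨?_, fun p hp => h _ hp⟩
      split_ifs with h0
      · exact h [] h0
      · trivial
    · rintro ⟨h1, h2⟩ l hl
      cases l with
      | nil => rw [if_pos hl] at h1; exact h1
      | cons p v => exact h2 (p, v) hl
  have hmeas : MeasurableSet ((s' : Set ((Fin m × ℕ) × List (Fin m × ℕ))).pi
      fun p => t (p.1 :: p.2)) := MeasurableSet.pi s'.countable_toSet fun _ _ => ht _
  rw [hpre, Measure.prod_prod, ← Measure.map_apply (by fun_prop) hmeas]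
  unfold sampleLaw
  rw [Measure.infinitePi_map_curry_symm, Measure.infinitePi_pi _ fun _ _ => ht _]
  have hs : ∏ i ∈ s, offspringLaw rate markLaw (t i) =
      (∏ i ∈ s with i = [], offspringLaw rate markLaw (t i)) *
        ∏ i ∈ s with i ≠ [], offspringLaw rate markLaw (t i) :=
    (Finset.prod_filter_mul_prod_filter_not s _ _).symm
  rw [hs]
  congr 1
  · by_cases h0 : [] ∈ s
    · have : s.filter (· = []) = {[]} := by ext l; simp; rintro rfl; exact h0
      simp [t₀, h0, this]
    · have : s.filter (· = []) = ∅ := by ext l; simp; rintro hl rfl; exact h0 hl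
      simp [t₀, h0, this]
  · refine Finset.prod_bij (fun p _ => p.1 :: p.2) ?_ ?_ ?_ ?_
    · intro p hp
      simpa using (hs' p).1 hp
    · rintro ⟨a, b⟩ _ ⟨c, d⟩ _ h
      simpa using h
    · intro l hl
      cases l with
      | nil => simp at hl
      | cons p v => exact ⟨(p, v), (hs' _).2 (Finset.mem_filter.1 hl).1, rfl⟩
    · intro p _
      rfl

/-! ### The generating functional of the subtrees of the root -/

theorem coe_prod_map_children {d : ℕ} (z : MarkedTree n d → ℝ≥0) (ω : Sample n m) (i : Fin n) :
    ((((children d ω i).map z).prod : ℝ≥0) : ℝ≥0∞) =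
      ∏ p ∈ Finset.univ.sigma fun j => Finset.range ((ω []).1 i j),
        (z (familyTree d (fun v => ω ((p.1, p.2) :: v)) ((ω []).2 p.1 p.2)) : ℝ≥0∞) := by
  rw [Finset.prod_sigma, children, ← Multiset.coe_mapAddMonoidHom, map_sum,
    Multiset.prod_sum, ENNReal.ofNNReal_finsetProd]
  refine Finset.prod_congr rfl fun j _ => ?_
  rw [Multiset.coe_mapAddMonoidHom, Multiset.map_map, ← ENNReal.ofNNReal_finsetProd]
  rfl

/-- A product of functions of distinct coordinates, under the law of the marks of an individual. -/
theorem lintegral_prod_marks (c : Fin m → ℕ) (G : Fin n → ℝ≥0∞) :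
    ∫⁻ a, ∏ p ∈ Finset.univ.sigma fun j => Finset.range (c j), G (a p.1 p.2)
      ∂(Measure.pi fun j => Measure.infinitePi fun _ : ℕ => (markLaw j).toMeasure) =
      ∏ j, (∫⁻ a, G a ∂(markLaw j).toMeasure) ^ c j := by
  rw [← Measure.infinitePi_eq_pi]
  have hind := iIndepFun_uncurry_infinitePi (X := fun (_ : Fin m) (_ : ℕ) (a : Fin n) => G a)
    (fun j (_ : ℕ) => (markLaw j).toMeasure) fun _ _ => Measurable.of_discrete
  rw [lintegral_prod_eq_prod_lintegral_of_indepFun _ _ hind fun p =>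
    Measurable.comp Measurable.of_discrete (by fun_prop), Finset.prod_sigma]
  refine Finset.prod_congr rfl fun j _ => ?_
  have : ∀ r : ℕ, ∫⁻ a : Fin m → ℕ → Fin n, G (a j r)
      ∂(Measure.infinitePi fun j => Measure.infinitePi fun _ : ℕ => (markLaw j).toMeasure) =
      ∫⁻ a, G a ∂(markLaw j).toMeasure := by
    intro r
    have h1 := (measurePreserving_eval_infinitePi
      (fun _ : ℕ => (markLaw j).toMeasure) r).comp
      (measurePreserving_eval_infinitePi
        (fun j => Measure.infinitePi fun _ : ℕ => (markLaw j).toMeasure) j)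
    exact h1.lintegral_comp (f := G) Measurable.of_discrete
  simp [this]

/-- A product of functions of distinct coordinates, under the law of the numbers of
children. -/
theorem lintegral_prod_counts (i : Fin n) (F : Fin m → ℕ → ℝ≥0∞) :
    ∫⁻ c, ∏ j, F j (c i j)
      ∂(Measure.pi fun i => Measure.pi fun j => poissonMeasure (rate i j)) =
      ∏ j, ∫⁻ k, F j k ∂poissonMeasure (rate i j) := by
  rw [(measurePreserving_eval (fun i => Measure.pi fun j => poissonMeasure (rate i j))
    i).lintegral_comp (f := fun c => ∏ j, F j (c j)) Measurable.of_discrete]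
  rw [← Measure.infinitePi_eq_pi]
  have hind := iIndepFun_infinitePi (P := fun j => poissonMeasure (rate i j)) (X := F)
    fun _ => Measurable.of_discrete
  rw [lintegral_prod_eq_prod_lintegral_of_indepFun _ _ hind fun j =>
    Measurable.comp Measurable.of_discrete (by fun_prop)]
  refine Finset.prod_congr rfl fun j _ => ?_
  exact (measurePreserving_eval_infinitePi (fun j => poissonMeasure (rate i j)) j).lintegral_comp
    (f := F j) Measurable.of_discrete

/-- The generating functional of the subtrees of the root. -/
theorem lintegral_prod_map_children {d : ℕ} (z : MarkedTree n d → ℝ≥0) (i : Fin n) :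
    ∫⁻ ω, (((children d ω i).map z).prod : ℝ≥0) ∂sampleLaw rate markLaw =
      ∏ j, ∫⁻ k, (∫⁻ a, ∫⁻ ω, z (familyTree d ω a) ∂sampleLaw rate markLaw
        ∂(markLaw j).toMeasure) ^ k ∂poissonMeasure (rate i j) := by
  set G : Fin n → ℝ≥0∞ := fun a => ∫⁻ ω, z (familyTree d ω a) ∂sampleLaw rate markLaw with hG
  have hmeas : Measurable fun ω : Sample n m =>
      ((((children d ω i).map z).prod : ℝ≥0) : ℝ≥0∞) :=
    (Measurable.of_discrete (f := fun M : Multiset (MarkedTree n d) =>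
      (((M.map z).prod : ℝ≥0) : ℝ≥0∞))).comp (measurable_children (measurable_familyTree d) i)
  have hsub : ∀ o : Offspring n m,
      ∫⁻ η, (((children d (graft (o, η)) i).map z).prod : ℝ≥0)
        ∂(Measure.infinitePi fun _ : Fin m × ℕ => sampleLaw rate markLaw) =
      ∏ p ∈ Finset.univ.sigma fun j => Finset.range (o.1 i j), G (o.2 p.1 p.2) := by
    intro o
    simp_rw [coe_prod_map_children]
    have hm : ∀ p : Fin m × ℕ, Measurable fun ω : Sample n m =>
        (z (familyTree d ω (o.2 p.1 p.2)) : ℝ≥0∞) := fun p =>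
      (Measurable.of_discrete (f := fun t : MarkedTree n d => (z t : ℝ≥0∞))).comp
        (measurable_familyTree d _)
    have hind : iIndepFun (fun (p : (_ : Fin m) × ℕ) (η : Fin m × ℕ → Sample n m) =>
        (z (familyTree d (η (p.1, p.2)) (o.2 p.1 p.2)) : ℝ≥0∞))
        (Measure.infinitePi fun _ : Fin m × ℕ => sampleLaw rate markLaw) :=
      (iIndepFun_infinitePi (P := fun _ : Fin m × ℕ => sampleLaw rate markLaw)
        hm).precomp (Equiv.sigmaEquivProd (Fin m) ℕ).injective
    change ∫⁻ η : Fin m × ℕ → Sample n m,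
      ∏ p ∈ Finset.univ.sigma fun j => Finset.range (o.1 i j),
        (z (familyTree d (η (p.1, p.2)) (o.2 p.1 p.2)) : ℝ≥0∞) ∂_ = _
    refine (lintegral_prod_eq_prod_lintegral_of_indepFun _ _ hind fun p =>
      (hm (p.1, p.2)).comp (by fun_prop)).trans ?_
    refine Finset.prod_congr rfl fun p _ => ?_
    exact (measurePreserving_eval_infinitePi (fun _ : Fin m × ℕ => sampleLaw rate markLaw)
      (p.1, p.2)).lintegral_comp (hm (p.1, p.2))
  have hGm : Measurable fun o : Offspring n m =>
      ∏ p ∈ Finset.univ.sigma fun j => Finset.range (o.1 i j), G (o.2 p.1 p.2) := by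
    simp_rw [← hsub]
    exact Measurable.lintegral_prod_right' (hmeas.comp measurable_graft)
  -- Integrate over the subtrees first, then over the marks of the children, then over their
  -- numbers.
  rw [← map_graft, lintegral_map hmeas measurable_graft]
  refine (lintegral_prod _ (hmeas.comp measurable_graft).aemeasurable).trans ?_
  simp only [Function.comp_apply, hsub]
  rw [offspringLaw, lintegral_prod _ hGm.aemeasurable]
  simp_rw [lintegral_prod_marks markLaw]
  exact lintegral_prod_counts rate i fun j k => (∫⁻ a, G a ∂(markLaw j).toMeasure) ^ k

end Laws

section Intensities

variable {n m : ℕ}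

/-! ### Processes with the same intensities of marks -/

/-- The generating functional of the subtrees of the root depends only on the intensities of the
marks of the children and on the laws of the subtrees. -/
theorem lintegral_prod_map_children_eq_exp (rate : Fin n → Fin m → ℝ≥0)
    (markLaw : Fin m → PMF (Fin n)) {d : ℕ} (z : MarkedTree n d → ℝ≥0) (hz : ∀ t, z t ≤ 1)
    (i : Fin n) :
    ∫⁻ ω, (((children d ω i).map z).prod : ℝ≥0) ∂sampleLaw rate markLaw =
      ENNReal.ofReal (Real.exp (∑ a, (∑ j, rate i j * (markLaw j a).toReal) *
        ((∫⁻ ω, z (familyTree d ω a) ∂sampleLaw rate markLaw).toReal - 1))) := by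
  have hG : ∀ a, ∫⁻ ω, z (familyTree d ω a) ∂sampleLaw rate markLaw ≤ 1 := by
    intro a
    calc ∫⁻ ω, z (familyTree d ω a) ∂sampleLaw rate markLaw
        ≤ ∫⁻ _, 1 ∂sampleLaw rate markLaw :=
          lintegral_mono fun ω => ENNReal.coe_le_one_iff.2 (hz _)
      _ = 1 := by simp
  generalize hGdef : (fun a => ∫⁻ ω, z (familyTree d ω a) ∂sampleLaw rate markLaw) = G at hG
  have hG' : ∀ a, ∫⁻ ω, z (familyTree d ω a) ∂sampleLaw rate markLaw = G a :=
    fun a => congrFun hGdef a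
  have hG1 : ∀ a, G a ≤ 1 := fun a => hG' a ▸ hG a
  have hmark : ∀ j, ∫⁻ a, G a ∂(markLaw j).toMeasure =
      ENNReal.ofReal (∑ a, (markLaw j a).toReal * (G a).toReal) := by
    intro j
    rw [lintegral_fintype, ENNReal.ofReal_sum_of_nonneg fun a _ => by positivity]
    refine Finset.sum_congr rfl fun a _ => ?_
    rw [PMF.toMeasure_apply_singleton _ _ (measurableSet_singleton a),
      ENNReal.ofReal_mul ENNReal.toReal_nonneg, ENNReal.ofReal_toReal (PMF.apply_ne_top _ _),
      ENNReal.ofReal_toReal ((hG1 a).trans_lt ENNReal.one_lt_top).ne, mul_comm]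
  have hone : ∀ j, ∑ a, (markLaw j a).toReal = 1 := by
    intro j
    rw [← ENNReal.toReal_sum fun a _ => PMF.apply_ne_top _ _, ← tsum_fintype (L := .unconditional _),
      PMF.tsum_coe, ENNReal.toReal_one]
  rw [lintegral_prod_map_children]
  simp_rw [hG', hmark]
  have hnn : ∀ j, 0 ≤ ∑ a, (markLaw j a).toReal * (G a).toReal :=
    fun j => Finset.sum_nonneg fun a _ => by positivity
  simp_rw [fun j => lintegral_pow_poissonMeasure (rate i j) (hnn j)]
  rw [← ENNReal.ofReal_prod_of_nonneg fun j _ => (Real.exp_pos _).le, ← Real.exp_sum]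
  congr 2
  -- The exponents agree because each mark law has total mass 1, which spreads the `-1` over the
  -- marks.
  simp_rw [Finset.sum_mul]
  rw [Finset.sum_comm]
  refine Finset.sum_congr rfl fun j _ => ?_
  rw [← hone j, ← Finset.sum_sub_distrib, Finset.mul_sum]
  exact Finset.sum_congr rfl fun a _ => by rw [hone j]; ring

/-- Two marked branching processes with the same intensities of marks have the same law. -/
theorem map_familyTree_eq_of_intensity_eq {m' : ℕ} (rate : Fin n → Fin m → ℝ≥0)
    (markLaw : Fin m → PMF (Fin n)) (rate' : Fin n → Fin m' → ℝ≥0)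
    (markLaw' : Fin m' → PMF (Fin n))
    (h : ∀ i a, ∑ j, (rate i j : ℝ) * (markLaw j a).toReal =
      ∑ j, (rate' i j : ℝ) * (markLaw' j a).toReal) (d : ℕ) (i : Fin n) :
    (sampleLaw rate markLaw).map (fun ω => familyTree d ω i) =
      (sampleLaw rate' markLaw').map (fun ω => familyTree d ω i) := by
  induction d generalizing i with
  | zero =>
    change Measure.map (fun _ => (i : MarkedTree n 0)) _ = Measure.map (fun _ => i) _
    simp [Measure.map_const]
  | succ d ih =>
    have hm := measurable_children (measurable_familyTree (n := n) (m := m) d) i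
    have hm' := measurable_children (measurable_familyTree (n := n) (m := m') d) i
    have hc : (sampleLaw rate markLaw).map (fun ω => children d ω i) =
        (sampleLaw rate' markLaw').map (fun ω => children d ω i) := by
      have := Measure.isProbabilityMeasure_map (μ := sampleLaw rate markLaw) hm.aemeasurable
      have := Measure.isProbabilityMeasure_map (μ := sampleLaw rate' markLaw') hm'.aemeasurable
      refine measure_multiset_ext_of_lintegral_prod fun z hz => ?_
      rw [lintegral_map Measurable.of_discrete hm, lintegral_map Measurable.of_discrete hm',
        lintegral_prod_map_children_eq_exp _ _ z hz, lintegral_prod_map_children_eq_exp _ _ z hz]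
      -- The subtrees enter only through these means, which agree by the induction hypothesis for
      -- every mark `a`.
      have hz' : ∀ a, ∫⁻ ω, z (familyTree d ω a) ∂sampleLaw rate markLaw =
          ∫⁻ ω, z (familyTree d ω a) ∂sampleLaw rate' markLaw' := by
        intro a
        have hzm : Measurable fun t : MarkedTree n d => (z t : ℝ≥0∞) := Measurable.of_discrete
        rw [← lintegral_map hzm (measurable_familyTree d a), ih a,
          lintegral_map hzm (measurable_familyTree d a)]
      simp_rw [h, hz']
    have hnode : Measurable (MarkedTree.node (d := d) i) := Measurable.of_discrete
    have e := congrArg (Measure.map (MarkedTree.node i)) hc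
    rwa [Measure.map_map hnode hm, Measure.map_map hnode hm'] at e

/-- The family tree up to an earlier generation is a function of the one up to a later one. -/
theorem exists_familyTree_truncation (n : ℕ) {d e : ℕ} (h : d ≤ e) :
    ∃ τ : MarkedTree n e → MarkedTree n d, ∀ (m : ℕ) (ω : Sample n m) (i : Fin n),
      τ (familyTree e ω i) = familyTree d ω i := by
  induction d generalizing e with
  | zero =>
    cases e with
    | zero => exact ⟨id, fun _ _ _ => rfl⟩
    | succ e => exact ⟨fun t => (show Fin n × Multiset (MarkedTree n e) from t).1,
        fun _ _ _ => rfl⟩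
  | succ d ih =>
    cases e with
    | zero => omega
    | succ e =>
      obtain ⟨τ, hτ⟩ := ih (Nat.succ_le_succ_iff.1 h)
      refine ⟨fun t => MarkedTree.node (show Fin n × Multiset (MarkedTree n e) from t).1
        ((show Fin n × Multiset (MarkedTree n e) from t).2.map τ), fun m ω i => ?_⟩
      change MarkedTree.node i ((children e ω i).map τ) = MarkedTree.node i (children d ω i)
      congr 1
      simp only [children]
      rw [← Multiset.coe_mapAddMonoidHom, map_sum]
      refine Finset.sum_congr rfl fun j _ => ?_
      simp [Multiset.map_map, hτ]

theorem measurable_process (i₀ : Fin n) : Measurable (process i₀ : Sample n m → _) :=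
  measurable_pi_iff.2 fun d => measurable_familyTree d i₀

/-- A law on sequences is fixed by its finite marginals, and all generations in a finite set `I` are
truncations of the tree of height `I.sup id`. -/
theorem identDistrib_process_of_intensity_eq {m' : ℕ} (rate : Fin n → Fin m → ℝ≥0)
    (markLaw : Fin m → PMF (Fin n)) (rate' : Fin n → Fin m' → ℝ≥0)
    (markLaw' : Fin m' → PMF (Fin n))
    (h : ∀ i a, ∑ j, (rate i j : ℝ) * (markLaw j a).toReal =
      ∑ j, (rate' i j : ℝ) * (markLaw' j a).toReal) (i₀ : Fin n) :
    IdentDistrib (process i₀) (process i₀) (sampleLaw rate markLaw)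
      (sampleLaw rate' markLaw') := by
  refine ⟨(measurable_process i₀).aemeasurable, (measurable_process i₀).aemeasurable, ?_⟩
  have := Measure.isProbabilityMeasure_map (μ := sampleLaw rate markLaw)
    (measurable_process i₀).aemeasurable
  have := Measure.isProbabilityMeasure_map (μ := sampleLaw rate' markLaw')
    (measurable_process i₀).aemeasurable
  refine IsProjectiveLimit.unique
    (P := fun I => ((sampleLaw rate markLaw).map (process i₀)).map I.restrict)
    (fun I => rfl) fun I => ?_
  choose τ hτ using fun d : I =>
    exists_familyTree_truncation n (Finset.le_sup (f := id) d.2 : (d : ℕ) ≤ I.sup id)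
  have key : ∀ {k : ℕ} (ρ : Measure (Sample n k)), (ρ.map (process i₀)).map I.restrict =
      (ρ.map fun ω => familyTree (I.sup id) ω i₀).map fun t d => τ d t := by
    intro k ρ
    rw [Measure.map_map (Finset.measurable_restrict I) (measurable_process i₀),
      Measure.map_map Measurable.of_discrete (measurable_familyTree _ i₀)]
    congr 1
    ext ω d
    exact (hτ d k ω i₀).symm
  change _ = ((sampleLaw rate markLaw).map (process i₀)).map I.restrict
  rw [key, key, map_familyTree_eq_of_intensity_eq rate markLaw rate' markLaw' h]

/-! ### The process with one type per class -/

theorem identDistrib_process_mbpLaw_bpLaw {A : Matrix (Fin n) (Fin n) ℝ} (hA : A.IsAdjMatrix)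
    {P : Fin n → Fin m} (hP : IsCanonical A P) (ℓ : ℝ≥0) (i₀ : Fin n) :
    IdentDistrib (process i₀) (process i₀) (mbpLaw A ℓ P i₀) (bpLaw A ℓ) := by
  classical
  refine identDistrib_process_of_intensity_eq _ _ _ _ (fun i a => ?_) i₀
  have hR : ∑ j, (bpRate A ℓ i j : ℝ) * (PMF.pure j a).toReal = ℓ * A i a := by
    rw [Finset.sum_eq_single a]
    · have : 0 ≤ A i a := by rcases hA.zero_or_one i a with h | h <;> simp [h]
      simp [bpRate, this]
    · intro j _ hj
      simp [PMF.pure_apply, Ne.symm hj]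
    · simp
  have ha : a ∈ cls P (P a) := by simp [cls]
  have hne : (cls P (P a)).Nonempty := ⟨a, ha⟩
  -- Identical rows move the first endpoint within its class, and symmetry then moves the second.
  have hproxy : (proxy A P (P i) (P a) : ℝ) = A i a := by
    have hiff : (∀ u ∈ cls P (P i), ∀ v ∈ cls P (P a), A u v = 1) ↔ A i a = 1 := by
      constructor
      · intro h
        exact h i (by simp [cls]) a ha
      · intro h u hu v hv
        rw [hP u i (by simpa [cls] using hu) v, hA.symm.apply,
          hP v a (by simpa [cls] using hv) i, hA.symm.apply, h]
    unfold proxy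
    rcases hA.zero_or_one i a with h | h
    · rw [if_neg (by rw [hiff, h]; norm_num), h]; rfl
    · rw [if_pos (hiff.2 h), h]; rfl
  rw [hR, Finset.sum_eq_single (P a)]
  · have hcard : ((cls P (P a)).card : ℝ) ≠ 0 := by
      exact_mod_cast Finset.card_ne_zero.2 hne
    rw [mbpMark, dif_pos hne, PMF.uniformOfFinset_apply_of_mem hne ha, mbpRate]
    push_cast
    rw [hproxy]
    simp only [ENNReal.toReal_inv, ENNReal.toReal_natCast]
    field_simp
  · intro j _ hj
    by_cases hjn : (cls P j).Nonempty
    · rw [mbpMark, dif_pos hjn, PMF.uniformOfFinset_apply_of_notMem hjn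
        (by simpa [cls] using Ne.symm hj)]
      simp
    -- For an empty class the rate is 0, so the default mark contributes nothing.
    · rw [Finset.not_nonempty_iff_eq_empty] at hjn
      simp [mbpRate, hjn]
  · simp

end Intensities

/-! ### An exponential bound for spherical codes -/

section SphericalCode

variable {E ι : Type*} [NormedAddCommGroup E] [InnerProductSpace ℝ E]

open scoped RealInnerProductSpace

/-- A point of the unit ball lies in a bounded number of caps around the points of a code. -/
theorem card_le_of_mem_caps (v : ι → E) (hv : ∀ i, ‖v i‖ = 1)
    (h : ∀ i j, i ≠ j → ⟪v i, v j⟫ ≤ 11 / 25) {x : E} (hx : ‖x‖ ≤ 1) (I : Finset ι)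
    (hI : ∀ i ∈ I, 17 / 25 ≤ ⟪v i, x⟫) : I.card ≤ 25 := by
  classical
  have h1 : (I.card : ℝ) * (17 / 25) ≤ ‖∑ i ∈ I, v i‖ := by
    calc (I.card : ℝ) * (17 / 25) = ∑ i ∈ I, (17 / 25 : ℝ) := by simp
      _ ≤ ∑ i ∈ I, ⟪v i, x⟫ := Finset.sum_le_sum hI
      _ = ⟪∑ i ∈ I, v i, x⟫ := (sum_inner _ _ _).symm
      _ ≤ ‖∑ i ∈ I, v i‖ * ‖x‖ := real_inner_le_norm _ _
      _ ≤ ‖∑ i ∈ I, v i‖ := mul_le_of_le_one_right (norm_nonneg _) hx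
  have h2 : ‖∑ i ∈ I, v i‖ ^ 2 ≤ I.card * (I.card * (11 / 25) + 14 / 25) := by
    rw [← real_inner_self_eq_norm_sq, sum_inner, ← nsmul_eq_mul]
    refine Finset.sum_le_card_nsmul _ _ _ fun i hi => ?_
    rw [inner_sum]
    calc ∑ j ∈ I, ⟪v i, v j⟫ ≤ ∑ j ∈ I, ((11 / 25 : ℝ) + if i = j then 14 / 25 else 0) := by
          refine Finset.sum_le_sum fun j _ => ?_
          split_ifs with hij
          · rw [← hij, real_inner_self_eq_norm_sq, hv]; norm_num
          · simpa using h i j hij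
      _ = I.card * (11 / 25) + 14 / 25 := by
          rw [Finset.sum_add_distrib, Finset.sum_ite_eq, if_pos hi]; simp
  have h3 : ((I.card : ℝ) * (17 / 25)) ^ 2 ≤ ‖∑ i ∈ I, v i‖ ^ 2 :=
    pow_le_pow_left₀ (by positivity) h1 2
  by_contra! hcon
  -- The two bounds give `(0.68² - 0.44) N ≤ 0.56`, that is `N ≤ 25`.
  have h4 : (26 : ℝ) ≤ I.card := by exact_mod_cast hcon
  nlinarith

/-- Linear map with eigenvalue `1 / 100` at the unit vector `v` and `71 / 100` on its orthogonal
complement. -/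
noncomputable def capMap (v : E) : E →ₗ[ℝ] E :=
  (71 / 100 : ℝ) • LinearMap.transvection ((-70 / 71 : ℝ) • (innerSL ℝ v : E →ₗ[ℝ] ℝ)) v

theorem capMap_apply (v y : E) :
    capMap v y = (71 / 100 : ℝ) • y + (-70 / 100 * ⟪v, y⟫) • v := by
  simp only [capMap, LinearMap.smul_apply, LinearMap.transvection.apply, smul_add, smul_smul]
  congr 2
  simp
  ring

theorem det_capMap [FiniteDimensional ℝ E] {v : E} (hv : ‖v‖ = 1) :
    (capMap v).det = (71 / 100) ^ Module.finrank ℝ E / 71 := by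
  rw [capMap, LinearMap.det_smul, LinearMap.transvection.det]
  simp [hv]
  ring

/-- With `t = ⟪v, y⟫`, the component along `v` is `0.69 + 0.01 t ≥ 0.68`, and the squared norm is at
most `(0.69 + 0.01 t)² + 0.71² (1 - t²) < 1`. -/
theorem capMap_mem_cap {v y : E} (hv : ‖v‖ = 1) (hy : ‖y‖ ≤ 1) :
    ‖(69 / 100 : ℝ) • v + capMap v y‖ ≤ 1 ∧
      17 / 25 ≤ ⟪v, (69 / 100 : ℝ) • v + capMap v y⟫ := by
  have ht : |⟪v, y⟫| ≤ 1 := by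
    refine (abs_real_inner_le_norm v y).trans ?_
    rw [hv, one_mul]; exact hy
  obtain ⟨ht1, ht2⟩ := abs_le.1 ht
  have hvv : ⟪v, v⟫ = 1 := by rw [real_inner_self_eq_norm_sq, hv]; norm_num
  have hyy : ⟪y, y⟫ ≤ 1 := by
    rw [real_inner_self_eq_norm_sq]; exact pow_le_one₀ (norm_nonneg _) hy
  constructor
  · rw [← abs_of_nonneg (norm_nonneg _), ← sq_le_one_iff_abs_le_one,
      ← real_inner_self_eq_norm_sq, capMap_apply]
    simp only [inner_add_left, inner_add_right, real_inner_smul_left, real_inner_smul_right, hvv,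
      real_inner_comm v y]
    nlinarith [sq_nonneg ⟪v, y⟫]
  · rw [capMap_apply]
    simp only [inner_add_right, real_inner_smul_right, hvv]
    linarith

/-- Unit vectors with pairwise inner products at most `0.44` are at most `C √2 ^ dim` in number. -/
theorem card_le_of_inner_le [FiniteDimensional ℝ E] [Fintype ι] (v : ι → E)
    (hv : ∀ i, ‖v i‖ = 1) (h : ∀ i j, i ≠ j → ⟪v i, v j⟫ ≤ 11 / 25) :
    (Fintype.card ι : ℝ) ≤ 1775 * √2 ^ Module.finrank ℝ E := by
  classical
  let _ : MeasurableSpace E := borel E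
  have : BorelSpace E := ⟨rfl⟩
  set D := Module.finrank ℝ E
  let B : Set E := Metric.closedBall 0 1
  -- Ellipsoids inside the caps, of volume `0.71 ^ D / 71` relative to the ball; no point lies in
  -- more than 25 of them. The semi-axis 0.71 is chosen above `1 / √2`, and `1775 = 25 * 71`.
  let C : ι → Set E := fun i => (fun y => (69 / 100 : ℝ) • v i + y) '' (capMap (v i) '' B)
  have hCB : ∀ i, ∀ x ∈ C i, ‖x‖ ≤ 1 ∧ 17 / 25 ≤ ⟪v i, x⟫ := by
    rintro i _ ⟨_, ⟨y, hy, rfl⟩, rfl⟩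
    exact capMap_mem_cap (hv i) (by simpa [B] using hy)
  have hvol : ∀ i, volume (C i) = ENNReal.ofReal ((71 / 100) ^ D / 71) * volume B := by
    intro i
    simp only [C]
    rw [Set.image_add_left, measure_preimage_add, Measure.addHaar_image_linearMap,
      det_capMap (hv i), abs_of_pos (by positivity)]
  have hCm : ∀ i, MeasurableSet (C i) := by
    intro i
    have hc : Continuous (capMap (v i)) := LinearMap.continuous_of_finiteDimensional _
    exact (((isCompact_closedBall 0 1).image hc).image (by fun_prop)).measurableSet
  have hsum : ∑ i, volume (C i) ≤ 25 * volume B := by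
    calc ∑ i, volume (C i) = ∑ i, ∫⁻ x, (C i).indicator 1 x := by
          exact Finset.sum_congr rfl fun i _ => (lintegral_indicator_one (hCm i)).symm
      _ = ∫⁻ x, ∑ i, (C i).indicator 1 x :=
          (lintegral_finsetSum _ fun i _ => measurable_one.indicator (hCm i)).symm
      _ ≤ ∫⁻ x, B.indicator (fun _ => 25) x := by
          refine lintegral_mono fun x => ?_
          have hcount : ∑ i, (C i).indicator (1 : E → ℝ≥0∞) x =
              (Finset.univ.filter fun i => x ∈ C i).card := by
            simp [Set.indicator_apply]
          rw [hcount]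
          by_cases hx : x ∈ B
          · rw [Set.indicator_of_mem hx]
            have hcard := card_le_of_mem_caps v hv h (by simpa [B] using hx)
              (Finset.univ.filter fun i => x ∈ C i) fun i hi =>
                (hCB i x (Finset.mem_filter.1 hi).2).2
            exact (Nat.cast_le.2 hcard).trans (by norm_num)
          · rw [Set.indicator_of_notMem hx, Finset.filter_false_of_mem]
            · simp
            · intro i _ hxi
              exact hx (by simpa [B] using (hCB i x hxi).1)
      _ = 25 * volume B := by
          rw [lintegral_indicator Metric.isClosed_closedBall.measurableSet]; simp [B]
  have hB0 : volume B ≠ 0 := (Metric.measure_closedBall_pos volume 0 one_pos).ne'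
  have hB1 : volume B ≠ ⊤ := (isCompact_closedBall 0 1).measure_lt_top.ne
  have hmain : (Fintype.card ι : ℝ) * ((71 / 100) ^ D / 71) ≤ 25 := by
    simp_rw [hvol, Finset.sum_const, Finset.card_univ, nsmul_eq_mul, ← mul_assoc] at hsum
    rw [ENNReal.mul_le_mul_iff_left hB0 hB1, ← ENNReal.ofReal_natCast,
      ← ENNReal.ofReal_mul (by positivity)] at hsum
    exact (ENNReal.ofReal_le_ofReal_iff (by norm_num)).1 (by simpa using hsum)
  have hpow : 1 ≤ (71 / 100 : ℝ) ^ D * √2 ^ D := by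
    rw [← mul_pow]
    refine one_le_pow₀ ?_
    have : (100 / 71 : ℝ) ≤ √2 := Real.le_sqrt_of_sq_le (by norm_num)
    linarith
  have h71 : (Fintype.card ι : ℝ) * (71 / 100) ^ D ≤ 1775 := by linarith
  calc (Fintype.card ι : ℝ) ≤ Fintype.card ι * ((71 / 100 : ℝ) ^ D * √2 ^ D) :=
        le_mul_of_one_le_right (by positivity) hpow
    _ = (Fintype.card ι * (71 / 100 : ℝ) ^ D) * √2 ^ D := by ring
    _ ≤ 1775 * √2 ^ D := by gcongr

end SphericalCode

/-- Rows of zeros and ones at relative Hamming distance at least `0.28` in a space of dimension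
`r` are at most `C √2 ^ r`. -/
theorem card_le_of_hammingDist {V ι : Type*} [Fintype V] [Nonempty V] [Fintype ι]
    (a : ι → V → ℝ) (ha : ∀ i w, a i w = 0 ∨ a i w = 1) (R : Submodule ℝ (V → ℝ))
    (hR : ∀ i, a i ∈ R)
    (hdist : ∀ i j, i ≠ j → (7 / 25 : ℝ) * Fintype.card V ≤ hammingDist (a i) (a j)) :
    (Fintype.card ι : ℝ) ≤ 1775 * √2 ^ (Module.finrank ℝ R + 1) := by
  classical
  set N : ℝ := (Fintype.card V : ℝ)
  have hN : 0 < N := by simp only [N]; exact_mod_cast Fintype.card_pos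
  let e := (WithLp.linearEquiv 2 ℝ (V → ℝ)).symm
  -- The sign vectors `1 - 2 a` need the constant vector, hence one extra dimension.
  let F : Submodule ℝ (V → ℝ) := R ⊔ Submodule.span ℝ {1}
  let E : Submodule ℝ (EuclideanSpace ℝ V) := F.map (e : (V → ℝ) →ₗ[ℝ] EuclideanSpace ℝ V)
  have hE : Module.finrank ℝ E ≤ Module.finrank ℝ R + 1 := by
    rw [LinearEquiv.finrank_map_eq]
    refine (Submodule.finrank_add_le_finrank_add_finrank _ _).trans ?_
    gcongr
    exact (finrank_span_le_card _).trans (by simp)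
  let u : ι → EuclideanSpace ℝ V := fun i => (√N)⁻¹ • e (1 - (2 : ℝ) • a i)
  have huE : ∀ i, u i ∈ E := by
    intro i
    refine E.smul_mem _ (Submodule.mem_map_of_mem (F.sub_mem ?_ (F.smul_mem _ ?_)))
    · exact Submodule.mem_sup_right (Submodule.mem_span_singleton_self _)
    · exact Submodule.mem_sup_left (hR i)
  -- Relative distance at least 0.28 becomes inner product at most `1 - 0.56 = 0.44`.
  have hinner : ∀ i j, inner ℝ (u i) (u j) = 1 - 2 * (hammingDist (a i) (a j) : ℝ) / N := by
    intro i j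
    have hterm : ∀ w, (1 - 2 * a j w) * (1 - 2 * a i w) =
        1 - 2 * (if a i w ≠ a j w then 1 else 0 : ℝ) := by
      intro w
      rcases ha i w with h | h <;> rcases ha j w with h' | h' <;> rw [h, h'] <;> norm_num
    simp only [u]
    rw [real_inner_smul_left, real_inner_smul_right, PiLp.inner_apply]
    have : ∀ w, inner ℝ ((e (1 - (2 : ℝ) • a i)) w) ((e (1 - (2 : ℝ) • a j)) w) =
        (1 - 2 * a j w) * (1 - 2 * a i w) := fun w => by
      simp [e]
    rw [Finset.sum_congr rfl fun w _ => (this w).trans (hterm w), Finset.sum_sub_distrib,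
      ← Finset.mul_sum, Finset.sum_boole, ← mul_assoc, ← mul_inv, Real.mul_self_sqrt hN.le]
    simp only [Finset.sum_const, Finset.card_univ, nsmul_eq_mul, mul_one, hammingDist]
    field_simp
    rfl
  have hbound := card_le_of_inner_le (E := E) (fun i => ⟨u i, huE i⟩) ?_ ?_
  · refine hbound.trans ?_
    gcongr
    exact Real.one_le_sqrt.2 one_le_two
  · intro i
    have : ‖u i‖ ^ 2 = 1 := by rw [← real_inner_self_eq_norm_sq, hinner]; simp
    simpa using (pow_eq_one_iff_of_nonneg (norm_nonneg _) two_ne_zero).1 this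
  · intro i j hij
    rw [Submodule.coe_inner, hinner]
    have := (le_div_iff₀ hN).2 (hdist i j hij)
    rw [mul_div_assoc]
    linarith

/-! ### Ranks of submatrices -/

/-- Restriction of coordinates maps the column space onto that of the submatrix, with `x` in its
kernel. -/
theorem rank_submatrix_rows_add_one_le {V U K : Type*} [Fintype V] [Fintype U] [Fintype K]
    [DecidableEq K] (M : Matrix V K ℝ) (f : U → V) {x : V → ℝ}
    (hx : x ∈ LinearMap.range M.mulVecLin) (hx0 : x ≠ 0) (hxf : ∀ u, x (f u) = 0) :
    (M.submatrix f id).rank + 1 ≤ M.rank := by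
  let ρ := (LinearMap.funLeft ℝ ℝ f).domRestrict (LinearMap.range M.mulVecLin)
  have hrange : LinearMap.range (M.submatrix f id).mulVecLin = LinearMap.range ρ := by
    have : (M.submatrix f id).mulVecLin = (LinearMap.funLeft ℝ ℝ f).comp M.mulVecLin := by
      ext; simp [LinearMap.funLeft_apply]
    rw [this, LinearMap.range_comp, LinearMap.range_domRestrict]
  have hker : 0 < Module.finrank ℝ (LinearMap.ker ρ) := by
    have hmem : (⟨x, hx⟩ : LinearMap.range M.mulVecLin) ∈ LinearMap.ker ρ := by
      ext u
      exact hxf u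
    have : Nontrivial (LinearMap.ker ρ) := by
      rw [Submodule.nontrivial_iff_ne_bot]
      intro h
      rw [h, Submodule.mem_bot] at hmem
      exact hx0 (congrArg Subtype.val hmem)
    exact Module.finrank_pos (R := ℝ) (M := LinearMap.ker ρ)
  have := LinearMap.finrank_range_add_finrank_ker ρ
  rw [Matrix.rank, Matrix.rank, hrange]
  omega

/-! ### Counting -/

/-- If no fibre of `f` has more than two elements, then its values are at least half as many as
its arguments, singleton fibres being counted twice. -/
theorem card_add_card_singles_le {α β : Type*} [Fintype α] [DecidableEq α] [DecidableEq β]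
    (f : α → β) (Z : Finset α) (hZ : ∀ z ∈ Z, ∀ b, f b = f z → b = z)
    (h : ∀ a b c, f a = f b → f a = f c → a ≠ b → a ≠ c → b = c) :
    Fintype.card α + Z.card ≤ 2 * (Finset.univ.image f).card := by
  have h1 : Fintype.card α =
      ∑ b ∈ Finset.univ.image f, (Finset.univ.filter fun a => f a = b).card :=
    Finset.card_eq_sum_card_image f Finset.univ
  have h2 : Z.card = ∑ b ∈ Finset.univ.image f, (Z.filter fun a => f a = b).card :=
    Finset.card_eq_sum_card_fiberwise fun a _ => by simp
  rw [h1, h2, ← Finset.sum_add_distrib, mul_comm, ← smul_eq_mul]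
  refine Finset.sum_le_card_nsmul _ _ _ fun b _ => ?_
  rcases (Z.filter fun a => f a = b).eq_empty_or_nonempty with hb | ⟨z, hz⟩
  · rw [hb, Finset.card_empty, add_zero]
    by_contra! hcon
    obtain ⟨a₁, a₂, a₃, h1, h2, h3, h12, h13, h23⟩ := Finset.two_lt_card_iff.1 hcon
    simp only [Finset.mem_filter, Finset.mem_univ, true_and] at h1 h2 h3
    exact h23 (h a₁ a₂ a₃ (h1.trans h2.symm) (h1.trans h3.symm) h12 h13)
  · obtain ⟨hzZ, hzb⟩ := Finset.mem_filter.1 hz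
    have e : ∀ a, f a = b → a = z := fun a ha => hZ z hzZ a (ha.trans hzb.symm)
    have c1 : (Finset.univ.filter fun a => f a = b).card ≤ 1 :=
      Finset.card_le_one.2 fun a ha a' ha' =>
        (e a (Finset.mem_filter.1 ha).2).trans (e a' (Finset.mem_filter.1 ha').2).symm
    have c2 : (Z.filter fun a => f a = b).card ≤ 1 :=
      Finset.card_le_one.2 fun a ha a' ha' =>
        (e a (Finset.mem_filter.1 ha).2).trans (e a' (Finset.mem_filter.1 ha').2).symm
    omega

/-- The Plotkin bound. -/
theorem plotkin_bound {ι V : Type*} [Fintype V] [DecidableEq ι] [DecidableEq V] (a : ι → V → ℝ)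
    (ha : ∀ i w, a i w = 0 ∨ a i w = 1) (M : Finset ι) (L : Finset V) (d : ℕ)
    (hd : ∀ i ∈ M, ∀ j ∈ M, i ≠ j → d ≤ hammingDist (a i) (a j))
    (hL : ∀ i ∈ M, ∀ j ∈ M, ∀ w, a i w ≠ a j w → w ∈ L) :
    (2 * d * M.card : ℝ) ≤ L.card * M.card + 2 * d := by
  rcases M.eq_empty_or_nonempty with rfl | hM
  · simp
  have hMpos : (0 : ℝ) < M.card := by exact_mod_cast hM.card_pos
  have hdist : ∀ i ∈ M, ∀ j ∈ M, (hammingDist (a i) (a j) : ℝ) =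
      ∑ w ∈ L, (a i w + a j w - 2 * (a i w * a j w)) := by
    intro i hi j hj
    have hterm : ∀ w, a i w + a j w - 2 * (a i w * a j w) =
        (if a i w ≠ a j w then 1 else 0 : ℝ) := by
      intro w
      rcases ha i w with h | h <;> rcases ha j w with h' | h' <;> rw [h, h'] <;> norm_num
    simp_rw [hterm, Finset.sum_boole, hammingDist]
    congr 2
    ext w
    simpa using hL i hi j hj w
  have hlow : (d : ℝ) * (M.card * M.card - M.card) ≤
      ∑ i ∈ M, ∑ j ∈ M, (hammingDist (a i) (a j) : ℝ) := by
    have : ∀ i ∈ M, (d : ℝ) * (M.card - 1) ≤ ∑ j ∈ M, (hammingDist (a i) (a j) : ℝ) := by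
      intro i hi
      calc (d : ℝ) * (M.card - 1) = ∑ j ∈ M, ((d : ℝ) - if i = j then (d : ℝ) else 0) := by
            rw [Finset.sum_sub_distrib, Finset.sum_ite_eq, if_pos hi]; simp; ring
        _ ≤ _ := by
            refine Finset.sum_le_sum fun j hj => ?_
            split_ifs with hij
            · simp
            · simpa using hd i hi j hj hij
    calc (d : ℝ) * (M.card * M.card - M.card) = ∑ i ∈ M, (d : ℝ) * (M.card - 1) := by
          simp; ring
      _ ≤ _ := Finset.sum_le_sum this
  have hup : ∑ i ∈ M, ∑ j ∈ M, (hammingDist (a i) (a j) : ℝ) ≤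
      L.card * ((M.card : ℝ) ^ 2 / 2) := by
    calc ∑ i ∈ M, ∑ j ∈ M, (hammingDist (a i) (a j) : ℝ)
        = ∑ i ∈ M, ∑ j ∈ M, ∑ w ∈ L, (a i w + a j w - 2 * (a i w * a j w)) :=
          Finset.sum_congr rfl fun i hi => Finset.sum_congr rfl fun j hj => hdist i hi j hj
      _ = ∑ w ∈ L, ∑ i ∈ M, ∑ j ∈ M, (a i w + a j w - 2 * (a i w * a j w)) :=
          (Finset.sum_congr rfl fun i _ => Finset.sum_comm).trans Finset.sum_comm
      _ ≤ ∑ w ∈ L, ((M.card : ℝ) ^ 2 / 2) := by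
          refine Finset.sum_le_sum fun w _ => ?_
          have : ∑ i ∈ M, ∑ j ∈ M, (a i w + a j w - 2 * (a i w * a j w)) =
              2 * M.card * (∑ i ∈ M, a i w) - 2 * (∑ i ∈ M, a i w) ^ 2 := by
            have inner : ∀ i ∈ M, ∑ j ∈ M, (a i w + a j w - 2 * (a i w * a j w)) =
                (M.card - 2 * ∑ j ∈ M, a j w) * a i w + ∑ j ∈ M, a j w := by
              intro i _
              rw [Finset.sum_sub_distrib, Finset.sum_add_distrib, ← Finset.mul_sum,
                ← Finset.mul_sum, Finset.sum_const, nsmul_eq_mul]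
              ring
            rw [Finset.sum_congr rfl inner, Finset.sum_add_distrib, ← Finset.mul_sum,
              Finset.sum_const, nsmul_eq_mul]
            ring
          rw [this]
          -- A column with `c` ones contributes `2 c (|M| - c) ≤ |M|² / 2`.
          nlinarith [sq_nonneg ((M.card : ℝ) - 2 * ∑ i ∈ M, a i w)]
      _ = L.card * ((M.card : ℝ) ^ 2 / 2) := by simp
  have := hlow.trans hup
  refine le_of_mul_le_mul_right ?_ hMpos
  nlinarith

/-! ### The number of distinct rows of a symmetric matrix of zeros and ones -/


theorem row_mem_range {V : Type*} [Fintype V] [DecidableEq V] {A : Matrix V V ℝ} (hA : A.IsSymm)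
    (v : V) : A v ∈ LinearMap.range A.mulVecLin :=
  ⟨Pi.single v 1, by ext w; simp [hA.apply]⟩

/-- Deleting repeated rows and columns reduces a bound for the number of distinct rows of a
symmetric matrix to matrices without repeated rows. -/
theorem card_image_row_le {k : ℕ} {b : ℝ}
    (h : ∀ (V : Type u) [Fintype V] [DecidableEq V] (A : Matrix V V ℝ), A.IsSymm →
      (∀ i j, A i j = 0 ∨ A i j = 1) → Function.Injective A → A.rank ≤ k →
      (Fintype.card V : ℝ) ≤ b)
    {V : Type u} [Fintype V] (A : Matrix V V ℝ) (hA : A.IsSymm)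
    (h01 : ∀ i j, A i j = 0 ∨ A i j = 1) (hk : A.rank ≤ k) [DecidableEq (V → ℝ)] :
    ((Finset.univ.image fun v => A v).card : ℝ) ≤ b := by
  classical
  obtain ⟨s, hs, hinj⟩ : ∃ s : Finset V, s.image (fun v => A v) = Finset.univ.image (fun v => A v) ∧
      Set.InjOn (fun v => A v) s := by
    obtain ⟨s, -, hinj, hs⟩ := Finset.exists_subset_injOn_image_eq_of_surjOn (f := fun v => A v)
      Set.univ (Finset.univ.image fun v => A v) (by intro y hy; simpa using hy)
    exact ⟨s, hs, hinj⟩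
  have hrep : ∀ v, ∃ u ∈ s, A u = A v := by
    intro v
    have : A v ∈ s.image (fun v => A v) := hs ▸ Finset.mem_image_of_mem _ (Finset.mem_univ v)
    simpa using this
  have hcard : (Finset.univ.image fun v => A v).card = Fintype.card s := by
    rw [← hs, Finset.card_image_of_injOn hinj, Fintype.card_coe]
  rw [hcard]
  refine h s (A.submatrix Subtype.val Subtype.val) (hA.submatrix _) (fun i j => h01 _ _) ?_
    ((Matrix.rank_submatrix_le _ _ _).trans hk)
  intro p q hpq
  refine Subtype.ext (hinj p.2 q.2 (funext fun w => ?_))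
  obtain ⟨u, hu, huw⟩ := hrep w
  -- By symmetry equal rows give equal columns, so the columns in `s` already distinguish the rows.
  have e : ∀ v : V, A v w = A v u := fun v => by rw [← hA.apply, ← huw, hA.apply]
  simp only [e]
  exact congrFun hpq ⟨u, hu⟩

theorem hammingNorm_le_of_support_subset {V : Type*} [Fintype V] {x y : V → ℝ}
    (h : ∀ w, x w = 0 → y w = 0) : hammingNorm y ≤ hammingNorm x :=
  Finset.card_le_card fun w hw => by
    simp only [Finset.mem_filter, Finset.mem_univ, true_and] at hw ⊢
    exact fun hx => hw (h w hx)

/-- In a space of vectors, the support of a nonzero vector of minimal weight determines the vector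
up to a factor. -/
theorem exists_smul_eq_of_minimal_weight {V : Type*} [Fintype V] {R : Submodule ℝ (V → ℝ)}
    {x : V → ℝ} (hx : x ∈ R) (hx0 : x ≠ 0)
    (hmin : ∀ z ∈ R, z ≠ 0 → hammingNorm x ≤ hammingNorm z) {y : V → ℝ} (hy : y ∈ R)
    (h : ∀ w, x w = 0 → y w = 0) : ∃ c : ℝ, y = c • x := by
  obtain ⟨s, hs⟩ := Function.ne_iff.1 hx0
  -- This factor makes `y - c • x` vanish at `s` too, so its support is strictly smaller than that
  -- of `x`.
  refine ⟨y s / x s, ?_⟩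
  by_contra hne
  have hz := hmin (y - (y s / x s) • x) (R.sub_mem hy (R.smul_mem _ hx)) (sub_ne_zero.2 hne)
  refine absurd hz (not_le.2 (Finset.card_lt_card ?_))
  rw [Finset.ssubset_iff_of_subset]
  · refine ⟨s, by simpa using hs, ?_⟩
    have : x s ≠ 0 := hs
    simp [this]
  · intro w hw
    simp only [Finset.mem_filter, Finset.mem_univ, true_and] at hw ⊢
    intro hxw
    exact hw (by simp [hxw, h w hxw])

/-- If the difference `y` of two rows has minimal weight among the nonzero vectors of the range,
then the number of rows is bounded by twice the number of distinct rows of the submatrix in which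
`y` vanishes. -/
theorem card_le_of_minimal_difference {V : Type*} [Fintype V] [DecidableEq V] {A : Matrix V V ℝ}
    (hA : A.IsSymm) (h01 : ∀ i j, A i j = 0 ∨ A i j = 1) (hinj : Function.Injective A)
    {u₀ v₀ : V} (huv : u₀ ≠ v₀) {y : V → ℝ} (hy : y = A u₀ - A v₀)
    (hmin : ∀ z ∈ LinearMap.range A.mulVecLin, z ≠ 0 → hammingNorm y ≤ hammingNorm z)
    [DecidableEq ({w // y w = 0} → ℝ)] :
    Fintype.card V ≤ 2 * (Finset.univ.image fun u : {w // y w = 0} =>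
      A.submatrix (Subtype.val : {w // y w = 0} → V) (Subtype.val : {w // y w = 0} → V) u).card
        + 4 := by
  classical
  have hrow := row_mem_range hA
  have hyR : y ∈ LinearMap.range A.mulVecLin := hy ▸ Submodule.sub_mem _ (hrow _) (hrow _)
  have hy0 : y ≠ 0 := hy ▸ sub_ne_zero.2 fun e => huv (hinj e)
  obtain ⟨s₀, hs₀⟩ : ∃ s, y s ≠ 0 := Function.ne_iff.1 hy0
  have hyval : ∀ w, y w ≠ 0 → y w = 1 ∨ y w = -1 := by
    intro w hw
    have e : y w = A u₀ w - A v₀ w := by rw [hy]; rfl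
    rcases h01 u₀ w with h | h <;> rcases h01 v₀ w with h' | h' <;> rw [h, h'] at e <;>
      norm_num at e <;> tauto
  let U := {w // y w = 0}
  let f : U → U → ℝ := fun u => A.submatrix Subtype.val Subtype.val u
  have hpair : ∀ u v : U, f u = f v → u ≠ v →
      (∀ w, A u w - A v w = y w) ∨ ∀ w, A u w - A v w = -y w := by
    intro u v huv hne
    obtain ⟨c, hc⟩ := exists_smul_eq_of_minimal_weight hyR hy0 hmin
      (Submodule.sub_mem _ (hrow u) (hrow v)) (y := A u - A v) fun w hw =>
        sub_eq_zero.2 (congrFun huv ⟨w, hw⟩)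
    have hc' : ∀ w, A u w - A v w = c * y w := fun w => congrFun hc w
    have hc0 : c ≠ 0 := by
      rintro rfl
      rw [zero_smul] at hc
      exact hne (Subtype.ext (hinj (sub_eq_zero.1 hc)))
    have : c = 1 ∨ c = -1 := by
      have e := hc' s₀
      rcases hyval s₀ hs₀ with h | h <;> rcases h01 u s₀ with h1 | h1 <;>
        rcases h01 v s₀ with h2 | h2 <;> rw [h, h1, h2] at e <;>
        first
        | exact absurd (by linarith) hc0
        | exact Or.inl (by linarith)
        | exact Or.inr (by linarith)
    rcases this with rfl | rfl
    · exact Or.inl fun w => by rw [hc', one_mul]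
    · exact Or.inr fun w => by rw [hc', neg_one_mul]
  let Z : Finset U := Finset.univ.filter fun z => ∀ b, f b = f z → b = z
  have hUZ : Fintype.card U + Z.card ≤ 2 * (Finset.univ.image f).card := by
    refine card_add_card_singles_le f Z (fun z hz => (Finset.mem_filter.1 hz).2) ?_
    intro a b c hab hac hne1 hne2
    -- Among three equal restricted rows the differences would be `±y`, but a sum or difference of
    -- two such is an even multiple of `y`.
    by_contra hne3
    refine hs₀ ?_
    rcases hpair a b hab hne1 with h1 | h1 <;> rcases hpair a c hac hne2 with h2 | h2 <;>
      rcases hpair b c (hab.symm.trans hac) hne3 with h3 | h3 <;>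
      linarith [h1 s₀, h2 s₀, h3 s₀]
  have hUd : Fintype.card U + hammingNorm y = Fintype.card V := by
    rw [Fintype.card_subtype, hammingNorm, Finset.card_filter_add_card_filter_not,
      Finset.card_univ]
  let T : Finset V := Finset.univ.filter fun w => y w ≠ 0
  have hT : T.card = hammingNorm y := rfl
  -- Rows indexed by a level set `y = σ ≠ 0` can differ only on `L`: any other `w` has a partner `b`
  -- with `A w - A b = ±y`, and a nonzero difference of two 0/1 entries determines both.
  let L : Finset V := T ∪ Z.map (Function.Embedding.subtype _)
  have hLcard : L.card ≤ hammingNorm y + Z.card := by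
    refine (Finset.card_union_le _ _).trans ?_
    rw [Finset.card_map, hT]
  let M : ℝ → Finset V := fun σ => Finset.univ.filter fun s => y s = σ
  have hMT : (M 1).card + (M (-1)).card = hammingNorm y := by
    rw [← Finset.card_union_of_disjoint, ← hT]
    · congr 1
      ext w
      simp only [M, T, Finset.mem_union, Finset.mem_filter, Finset.mem_univ, true_and]
      constructor
      · rintro (h | h) <;> rw [h] <;> norm_num
      · exact hyval w
    · rw [Finset.disjoint_left]
      intro w h1 h2
      have h1 := (Finset.mem_filter.1 h1).2
      have h2 := (Finset.mem_filter.1 h2).2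
      linarith
  have hplotkin : ∀ σ : ℝ, σ ≠ 0 →
      (2 * hammingNorm y * (M σ).card : ℝ) ≤ L.card * (M σ).card + 2 * hammingNorm y := by
    intro σ hσ
    refine plotkin_bound A h01 (M σ) L (hammingNorm y) ?_ ?_
    · intro i _ j _ hij
      rw [hammingDist_comm, hammingDist_eq_hammingNorm]
      refine hmin _ (Submodule.add_mem _ (Submodule.neg_mem _ (hrow _)) (hrow _)) ?_
      rw [neg_add_eq_sub]
      exact sub_ne_zero.2 fun e => hij (hinj e)
    · intro s hs s' hs' w hw
      by_contra hwL
      simp only [L, Finset.mem_union, not_or] at hwL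
      have hyw : y w = 0 := by
        by_contra h
        exact hwL.1 (Finset.mem_filter.2 ⟨Finset.mem_univ _, h⟩)
      have hwZ : (⟨w, hyw⟩ : U) ∉ Z := fun h =>
        hwL.2 (Finset.mem_map.2 ⟨_, h, rfl⟩)
      simp only [Z, Finset.mem_filter, Finset.mem_univ, true_and, not_forall] at hwZ
      obtain ⟨b, hb, hne⟩ := hwZ
      have e1 : y s = σ := (Finset.mem_filter.1 hs).2
      have e2 : y s' = σ := (Finset.mem_filter.1 hs').2
      have key : A w s - A b s = A w s' - A b s' ∧ A w s - A b s ≠ 0 := by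
        rcases hpair ⟨w, hyw⟩ b hb.symm (Ne.symm hne) with h | h
        · have h1 := h s
          have h2 := h s'
          simp only at h1 h2
          exact ⟨by rw [h1, h2, e1, e2], by rw [h1, e1]; exact hσ⟩
        · have h1 := h s
          have h2 := h s'
          simp only at h1 h2
          exact ⟨by rw [h1, h2, e1, e2], by rw [h1, e1]; exact neg_ne_zero.2 hσ⟩
      apply hw
      rw [← hA.apply s w, ← hA.apply s' w]
      obtain ⟨k1, k2⟩ := key
      rcases h01 w s with h1 | h1 <;> rcases h01 w s' with h2 | h2 <;>
        rcases h01 b s with h3 | h3 <;> rcases h01 b s' with h4 | h4 <;>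
        rw [h1, h3, h2, h4] at k1 <;> rw [h1, h3] at k2 <;> rw [h1, h2] <;>
        first | linarith | exact absurd (by norm_num) k2
  have hp := hplotkin 1 one_ne_zero
  have hm := hplotkin (-1) (by norm_num)
  have hd : 0 < hammingNorm y := hammingNorm_pos_iff.2 hy0
  change Fintype.card V ≤ 2 * (Finset.univ.image f).card + 4
  -- Failure gives `|L| ≤ 2 d - 5` for `d = hammingNorm y`. Plotkin then yields `5 |M σ| ≤ 2 d` for
  -- `σ = ±1`, and the sum is `5 d ≤ 4 d`, a contradiction.
  by_contra! hcon
  have hL : L.card + 5 ≤ 2 * hammingNorm y := by omega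
  have hd' : (0 : ℝ) < hammingNorm y := by exact_mod_cast hd
  have hL' : (L.card : ℝ) + 5 ≤ 2 * hammingNorm y := by exact_mod_cast hL
  have hMT' : ((M 1).card : ℝ) + (M (-1)).card = hammingNorm y := by exact_mod_cast hMT
  nlinarith

/-- A symmetric matrix of zeros and ones without repeated rows has `O(√2 ^ rank)` rows. -/
theorem card_le_of_rank_le (r : ℕ) : ∀ (V : Type u) [Fintype V] [DecidableEq V]
    (A : Matrix V V ℝ), A.IsSymm → (∀ i j, A i j = 0 ∨ A i j = 1) → Function.Injective A →
    A.rank ≤ r → (Fintype.card V : ℝ) ≤ 3000 * √2 ^ r - 4 := by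
  induction r using Nat.strong_induction_on with
  | _ r ih =>
  intro V _ _ A hA h01 hinj hr
  classical
  have hs1 : (1 : ℝ) ≤ √2 := Real.one_le_sqrt.2 one_le_two
  have hs2 : √2 ≤ (1.4143 : ℝ) := Real.sqrt_le_iff.2 (by norm_num)
  have hs3 : (1.414 : ℝ) ≤ √2 := Real.le_sqrt_of_sq_le (by norm_num)
  have hone : ∀ k : ℕ, (1 : ℝ) ≤ √2 ^ k := fun k => one_le_pow₀ hs1
  by_cases hA0 : A = 0
  · have : Subsingleton V := ⟨fun u v => hinj (by rw [hA0]; rfl)⟩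
    have : (Fintype.card V : ℝ) ≤ 1 := by exact_mod_cast Fintype.card_le_one_iff_subsingleton.2 this
    linarith [hone r]
  set R := LinearMap.range A.mulVecLin
  have hrow : ∀ v, A v ∈ R := row_mem_range hA
  obtain ⟨v₁, hv₁⟩ : ∃ v, A v ≠ 0 := by
    by_contra! h
    exact hA0 (funext h)
  have : Nonempty V := ⟨v₁⟩
  obtain ⟨x, ⟨hxR, hx0⟩, hxmin⟩ := (measure (hammingNorm : (V → ℝ) → ℕ)).wf.has_min
    {x | x ∈ R ∧ x ≠ 0} ⟨A v₁, hrow v₁, hv₁⟩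
  replace hxmin : ∀ z ∈ R, z ≠ 0 → hammingNorm x ≤ hammingNorm z :=
    fun z hz hz0 => not_lt.1 (hxmin z ⟨hz, hz0⟩)
  -- The threshold 0.28 lies below `1 - 1 / √2`, as the restriction step requires, and is large
  -- enough for the code bound.
  by_cases hfar : (7 / 25 : ℝ) * Fintype.card V ≤ hammingNorm x
  · have hcode := card_le_of_hammingDist A h01 R hrow fun i j hij => hfar.trans (by
      rw [hammingDist_comm, hammingDist_eq_hammingNorm, neg_add_eq_sub]
      exact_mod_cast hxmin _ (R.sub_mem (hrow _) (hrow _)) (sub_ne_zero.2 fun e => hij (hinj e)))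
    have hpow : √2 ^ (Module.finrank ℝ R + 1) ≤ √2 ^ (r + 1) :=
      pow_le_pow_right₀ hs1 (Nat.succ_le_succ hr)
    rw [pow_succ √2 r] at hpow
    nlinarith [hone r]
  have hrank : ∀ y ∈ R, y ≠ 0 →
      (A.submatrix id (Subtype.val : {w // y w = 0} → V)).rank + 1 ≤ A.rank := by
    intro y hy hy0
    have h := rank_submatrix_rows_add_one_le A (Subtype.val : {w // y w = 0} → V) hy hy0
      fun u => u.2
    rw [← Matrix.rank_transpose, Matrix.transpose_submatrix, hA.eq] at h
    exact h
  by_cases hpairs : Function.Injective (A.submatrix (Subtype.val : {w // x w = 0} → V)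
      (Subtype.val : {w // x w = 0} → V))
  · have h1 := hrank x hxR hx0
    have h2 : (A.submatrix (Subtype.val : {w // x w = 0} → V)
        (Subtype.val : {w // x w = 0} → V)).rank ≤ r - 1 := by
      have h3 := Matrix.rank_submatrix_le (A.submatrix id (Subtype.val : {w // x w = 0} → V))
        (Subtype.val : {w // x w = 0} → V) id
      rw [Matrix.submatrix_submatrix] at h3
      exact h3.trans (by omega)
    have hU := ih (r - 1) (by omega) {w // x w = 0} _ (hA.submatrix _) (fun i j => h01 _ _)
      hpairs h2
    have hUd : Fintype.card {w // x w = 0} + hammingNorm x = Fintype.card V := by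
      rw [Fintype.card_subtype, hammingNorm, Finset.card_filter_add_card_filter_not,
        Finset.card_univ]
    have hUd' : (Fintype.card {w // x w = 0} : ℝ) + hammingNorm x = Fintype.card V := by
      exact_mod_cast hUd
    have hpow : √2 ^ r = √2 ^ (r - 1) * √2 := by
      rw [← pow_succ]; congr 1; omega
    rw [hpow]
    nlinarith [hone (r - 1)]
  · simp only [Function.Injective, not_forall] at hpairs
    obtain ⟨u₀, v₀, huv, hne⟩ := hpairs
    have hne' : (u₀ : V) ≠ v₀ := fun e => hne (Subtype.ext e)
    obtain ⟨y, hy⟩ : ∃ y, y = A u₀ - A v₀ := ⟨_, rfl⟩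
    have hyx : ∀ w, x w = 0 → y w = 0 := fun w hw => by
      rw [hy]; exact sub_eq_zero.2 (congrFun huv ⟨w, hw⟩)
    have hyR : y ∈ R := hy ▸ R.sub_mem (hrow _) (hrow _)
    have hy0 : y ≠ 0 := hy ▸ sub_ne_zero.2 fun e => hne' (hinj e)
    have hymin : ∀ z ∈ R, z ≠ 0 → hammingNorm y ≤ hammingNorm z := fun z hz hz0 =>
      (hammingNorm_le_of_support_subset hyx).trans (hxmin z hz hz0)
    let g : {w // y w = 0} → V := Subtype.val
    have h1 : (A.submatrix id g).rank + 1 ≤ A.rank := hrank y hyR hy0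
    -- The columns `u₀` and `v₀` survive, so `y` is still in the column space and deleting the rows
    -- lowers the rank again.
    have h2 : (A.submatrix g g).rank + 1 ≤ (A.submatrix id g).rank := by
      refine rank_submatrix_rows_add_one_le (A.submatrix id g) g (x := y) ?_ hy0 fun u => u.2
      refine ⟨Pi.single ⟨u₀, hyx _ u₀.2⟩ 1 - Pi.single ⟨v₀, hyx _ v₀.2⟩ 1, ?_⟩
      ext w
      simp [Matrix.mulVec_sub, hy, g, hA.apply]
    have hK := card_image_row_le (ih (r - 2) (by omega)) (A.submatrix g g) (hA.submatrix _)
      (fun i j => h01 _ _) (by omega)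
    have hcard := card_le_of_minimal_difference hA h01 hinj hne' hy hymin
    have hcard' : (Fintype.card V : ℝ) ≤
        2 * ((Finset.univ.image fun u => A.submatrix g g u).card : ℝ) + 4 := by
      exact_mod_cast hcard
    -- The term `-4` in the bound is the fixed point of `t ↦ 2 t + 4`, so it absorbs the additive 4.
    have hpow : √2 ^ r = √2 ^ (r - 2) * 2 := by
      rw [show r = r - 2 + 2 by omega, pow_add, Real.sq_sqrt zero_le_two, Nat.add_sub_cancel]
    rw [hpow]
    linarith

/-! ### Labelling the twin classes and the growth of `f` -/

theorem twins_iff_row_eq {n : ℕ} {A : Matrix (Fin n) (Fin n) ℝ} (hA : A.IsAdjMatrix)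
    (u v : Fin n) : Twins A u v ↔ A u = A v := by
  refine ⟨fun h => funext h.2, fun h => ⟨?_, congrFun h⟩⟩
  -- Equal rows force non-adjacency, since `A u v = A v v = 0`.
  rw [h, hA.apply_diag]

/-- The classes of twins can be labelled by any set of labels that is large enough in terms of the
rank. -/
theorem exists_twin_labelling {k n m : ℕ} {A : Matrix (Fin n) (Fin n) ℝ} (hA : A.IsAdjMatrix)
    (hk : A.rank ≤ k) (hm : 3000 * √2 ^ k ≤ m) :
    ∃ P : Fin n → Fin m, ∀ u v, P u = P v ↔ Twins A u v := by
  classical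
  have hcard : (Finset.univ.image fun v => A v).card ≤ m := by
    have h := card_image_row_le (card_le_of_rank_le k) A hA.symm hA.zero_or_one hk
    exact_mod_cast (h.trans (by linarith) : ((Finset.univ.image fun v => A v).card : ℝ) ≤ m)
  let e := (Finset.univ.image fun v => A v).equivFin
  refine ⟨fun v => Fin.castLE hcard (e ⟨A v, Finset.mem_image_of_mem _ (Finset.mem_univ v)⟩),
    fun u v => ?_⟩
  rw [twins_iff_row_eq hA, (Fin.castLE_injective hcard).eq_iff, e.injective.eq_iff,
    Subtype.mk.injEq]

theorem isBigO_ceil_sqrt_two_pow :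
    (fun k : ℕ => (⌈3000 * √2 ^ k⌉₊ : ℝ)) =O[atTop] fun k : ℕ => (2 : ℝ) ^ ((k : ℝ) / 2) := by
  refine IsBigO.of_bound 3001 (Eventually.of_forall fun k => ?_)
  have hpow : (2 : ℝ) ^ ((k : ℝ) / 2) = √2 ^ k := by
    rw [Real.sqrt_eq_rpow, ← Real.rpow_natCast, ← Real.rpow_mul zero_le_two]
    congr 1
    ring
  have h1 : (1 : ℝ) ≤ √2 ^ k := one_le_pow₀ (Real.one_le_sqrt.2 one_le_two)
  rw [hpow, Real.norm_of_nonneg (by positivity), Real.norm_of_nonneg (by positivity)]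
  linarith [Nat.ceil_lt_add_one (show 0 ≤ 3000 * √2 ^ k by positivity)]

end KotlovLovasz

open KotlovLovasz in
theorem mainTheorem4 :
    ∃ f : ℕ → ℕ,
      (fun k => (f k : ℝ)) =O[atTop] (fun k : ℕ => (2 : ℝ) ^ ((k : ℝ) / 2)) ∧
      ∀ (k n : ℕ) (A : Matrix (Fin n) (Fin n) ℝ), A.IsAdjMatrix → A.rank ≤ k →
        (∃ P : Fin n → Fin (f k), ∀ u v, P u = P v ↔ Twins A u v) ∧
        ∀ P : Fin n → Fin (f k), IsCanonical A P →
          ∀ (ℓ : ℝ≥0) (i₀ : Fin n),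
            IdentDistrib (process i₀) (process i₀) (mbpLaw A ℓ P i₀) (bpLaw A ℓ) :=
  ⟨fun k => ⌈3000 * √2 ^ k⌉₊, isBigO_ceil_sqrt_two_pow, fun _ _ _ hA hk =>
    ⟨exists_twin_labelling hA hk (Nat.le_ceil _), fun _ hP ℓ i₀ =>
      identDistrib_process_mbpLaw_bpLaw hA hP ℓ i₀⟩⟩
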